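/- Let $A$ and $B$ be finite-dimensional Hilbert spaces with fixed orthonormal bases, let $T_B$ be the partial transpose on $B$, i.e. $\langle a b|T_B(Y)|a'b'\rangle=\langle a b'|Y|a'b\rangle$, and write $|Y|=\sqrt{Y^\dagger Y}$ and $\|Y\|_\alpha=(\operatorname{Tr}|Y|^\alpha)^{1/\alpha}$ for $1\le\alpha<\infty$, with $\|Y\|_\infty$ the operator norm. For a Hermitian operator $X\neq 0$ and a positive semidefinite operator $\sigma\ne0$ put $$\nu_\alpha(X\Vert\sigma)=\log_2\bigl\|\sigma^{\frac{1-\alpha}{2\alpha}}X\sigma^{\frac{1-\alpha}{2\alpha}}\bigr\|_\alpha\quad(1\le\alpha<\infty),\qquad \nu_\infty(X\Vert\sigma)=\log_2\bigl\|\sigma^{-1/2}X\sigma^{-1/2}\bigr\|_\infty$$ if $\operatorname{supp}(X)\subseteq\operatorname{supp}(\sigma)$ (powers of $\sigma$ being taken on its support), and $\nu_\alpha(X\Vert\sigma)=+\infty$ otherwise. Let $\mathrm{PPT}(A{:}B)=\{\sigma_{AB}:\sigma_{AB}\ge0,\ T_B(\sigma_{AB})\ge0,\ \operatorname{Tr}\sigma_{AB}=1\}$.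 For a bipartite state $\rho_{AB}$ (a positive semidefinite operator of unit trace on $A\otimes B$) let $$E_N(\rho_{AB})=\log_2\|T_B(\rho_{AB})\|_1,\qquad E_N^\alpha(\rho_{AB})=\inf_{\sigma_{AB}\in\mathrm{PPT}(A:B)}\nu_\alpha(T_B(\rho_{AB})\Vert\sigma_{AB})\quad(1\le\alpha\le\infty),$$ where $E_N^\infty$ is also called the max-logarithmic negativity $E_N^{\max}$. If $\rho_{AB}$ satisfies $T_B(|T_B(\rho_{AB})|)\ge0$, then all $\alpha$-logarithmic negativities of $\rho_{AB}$ are equal: $E_N^\alpha(\rho_{AB})=E_N(\rho_{AB})$ for every real $\alpha\ge1$, and also for $\alpha=\infty$, i.e. $E_N^{\max}(\rho_{AB})=E_N(\rho_{AB})$. -/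

import Mathlib

open scoped ComplexOrder

noncomputable section

namespace AlphaLogNeg

/-- A quantum state on `ℂ^ι`: a positive semidefinite matrix of unit trace. -/
def IsState {ι : Type*} [Fintype ι] (ρ : Matrix ι ι ℂ) : Prop :=
  ρ.PosSemidef ∧ ρ.trace = 1

/-- The partial transpose on the second factor, in the standard basis of `ℂ^A ⊗ ℂ^B = ℂ^(A × B)`:
`⟨a b| T_B(Y) |a' b'⟩ = ⟨a b'| Y |a' b⟩`. -/
def partialTranspose {A B : Type*} (Y : Matrix (A × B) (A × B) ℂ) : Matrix (A × B) (A × B) ℂ :=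
  Matrix.of fun x y => Y (x.1, y.2) (y.1, x.2)

/-- `PPT(A:B)`: the states whose partial transpose is positive semidefinite. -/
def PPT (A B : Type*) [Fintype A] [Fintype B] : Set (Matrix (A × B) (A × B) ℂ) :=
  {σ | IsState σ ∧ (partialTranspose σ).PosSemidef}

section Operators

variable {ι : Type*} [Fintype ι] [DecidableEq ι]

/-- The absolute value `|Y| = √(Y† Y)`. -/
def opAbs (Y : Matrix ι ι ℂ) : Matrix ι ι ℂ :=
  cfc Real.sqrt (Y.conjTranspose * Y)

/-- The `α`-norm `‖Y‖_α = (Tr |Y|^α)^(1/α)`, for real `α ≥ 1`. -/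
def schattenNorm (α : ℝ) (Y : Matrix ι ι ℂ) : ℝ :=
  (cfc (fun x : ℝ => x ^ α) (opAbs Y)).trace.re ^ (1 / α)

/-- The trace norm `‖Y‖_1 = Tr |Y|`. -/
def traceNorm (Y : Matrix ι ι ℂ) : ℝ :=
  (opAbs Y).trace.re

/-- The operator norm `‖Y‖_∞` of `Y` acting on the Hilbert space `ℂ^ι`. -/
def operatorNorm (Y : Matrix ι ι ℂ) : ℝ :=
  ‖Matrix.toEuclideanCLM (𝕜 := ℂ) Y‖

/-- The real power `σ^r` of a positive semidefinite `σ`, taken on the support of `σ` (and zero on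
the kernel), so that negative powers are generalized inverses. -/
def suppPow (σ : Matrix ι ι ℂ) (r : ℝ) : Matrix ι ι ℂ :=
  cfc (fun x : ℝ => if x = 0 then 0 else x ^ r) σ

/-- The support of a Hermitian operator: the orthogonal complement of its kernel. -/
def supp (X : Matrix ι ι ℂ) : Submodule ℂ (EuclideanSpace ℂ ι) :=
  (LinearMap.ker (Matrix.toEuclideanCLM (𝕜 := ℂ) X).toLinearMap)ᗮ

open Classical in
/-- `ν_α(X‖σ) = log₂ ‖σ^((1-α)/(2α)) X σ^((1-α)/(2α))‖_α` if `supp X ⊆ supp σ`, and `+∞` otherwise,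
for real `α ≥ 1`, a Hermitian `X ≠ 0` and a positive semidefinite `σ ≠ 0`. -/
def nu (α : ℝ) (X σ : Matrix ι ι ℂ) : EReal :=
  if supp X ≤ supp σ then
    ((Real.logb 2 (schattenNorm α
      (suppPow σ ((1 - α) / (2 * α)) * X * suppPow σ ((1 - α) / (2 * α)))) : ℝ) : EReal)
  else ⊤

open Classical in
/-- `ν_∞(X‖σ) = log₂ ‖σ^(-1/2) X σ^(-1/2)‖_∞` if `supp X ⊆ supp σ`, and `+∞` otherwise. -/
def nuInf (X σ : Matrix ι ι ℂ) : EReal :=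
  if supp X ≤ supp σ then
    ((Real.logb 2 (operatorNorm (suppPow σ (-1 / 2) * X * suppPow σ (-1 / 2))) : ℝ) : EReal)
  else ⊤

end Operators

section Negativities

variable {A B : Type*} [Fintype A] [DecidableEq A] [Fintype B] [DecidableEq B]

/-- The logarithmic negativity `E_N(ρ) = log₂ ‖T_B(ρ)‖_1`. -/
def logNegativity (ρ : Matrix (A × B) (A × B) ℂ) : ℝ :=
  Real.logb 2 (traceNorm (partialTranspose ρ))

/-- The `α`-logarithmic negativity `E_N^α(ρ) = inf_{σ ∈ PPT(A:B)} ν_α(T_B(ρ)‖σ)`, `1 ≤ α < ∞`. -/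
def alphaLogNegativity (α : ℝ) (ρ : Matrix (A × B) (A × B) ℂ) : EReal :=
  ⨅ σ ∈ PPT A B, nu α (partialTranspose ρ) σ

/-- The max-logarithmic negativity, `α = ∞`: `E_N^max(ρ) = inf_{σ ∈ PPT(A:B)} ν_∞(T_B(ρ)‖σ)`. -/
def maxLogNegativity (ρ : Matrix (A × B) (A × B) ℂ) : EReal :=
  ⨅ σ ∈ PPT A B, nuInf (partialTranspose ρ) σ

end Negativities

end AlphaLogNeg

end

open scoped ComplexOrder

noncomputable section

namespace AlphaLogNeg

/-! ### Functional calculus of Hermitian matrices and the norms in terms of eigenvalues. -/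

section FunctionalCalculus

open Matrix

variable {ι : Type*} [Fintype ι] [DecidableEq ι]

/-! Write X = T_B(ρ). The trace norm of X is a lower bound for every state σ, PPT or not. With Z =
σ^(-t) X σ^(-t), t = (α-1)/(2α) (t = 1/2 for α = ∞), the support condition gives X = σ^t Z σ^t, so
‖X‖₁ = Tr(sgn(X) X) = Tr(K Z) with K = σ^t sgn(X) σ^t and -σ^(2t) ≤ K ≤ σ^(2t). Reading the trace in
an eigenbasis of Z (`traceNorm_le_sum_overlap`) leaves a scalar sum over the eigenvalues of σ and Z,
weighted by the doubly stochastic matrix of squared overlaps. Hölder's inequality finishes it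
(`traceNorm_le_schattenNorm`, `traceNorm_le_operatorNorm`).

The bound is attained at σ = |X|/‖X‖₁: everything is then a function of X, and the norm is a
computation on eigenvalues. The hypothesis on T_B(|X|) serves only to put this σ in PPT
(`normalizedAbs_mem_PPT`). -/

theorem continuousOn_spectrum (f : ℝ → ℝ) (M : Matrix ι ι ℂ) : ContinuousOn f (spectrum ℝ M) :=
  Matrix.finite_real_spectrum.continuousOn f

theorem cfc_mul_cfc (f g : ℝ → ℝ) (M : Matrix ι ι ℂ) :
    cfc f M * cfc g M = cfc (fun x => f x * g x) M :=
  (cfc_mul f g M (continuousOn_spectrum f M) (continuousOn_spectrum g M)).symm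

theorem cfc_cfc (g f : ℝ → ℝ) {M : Matrix ι ι ℂ} (hM : M.IsHermitian) :
    cfc g (cfc f M) = cfc (fun x => g (f x)) M := by
  have hM' : IsSelfAdjoint M := hM
  have hc : ContinuousOn g (f '' spectrum ℝ M) :=
    (Matrix.finite_real_spectrum.image f).continuousOn g
  exact (cfc_comp' g f M hc (continuousOn_spectrum f M)).symm

theorem cfc_congr_of_isHermitian {f g : ℝ → ℝ} {M : Matrix ι ι ℂ} (hM : M.IsHermitian)
    (h : ∀ i, f (hM.eigenvalues i) = g (hM.eigenvalues i)) : cfc f M = cfc g M := by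
  refine cfc_congr fun x hx => ?_
  rw [hM.spectrum_real_eq_range_eigenvalues] at hx
  obtain ⟨i, rfl⟩ := hx
  exact h i

theorem isHermitian_cfc (f : ℝ → ℝ) (M : Matrix ι ι ℂ) : (cfc f M).IsHermitian :=
  cfc_predicate f M

theorem cfc_eq_conj_diagonal (f : ℝ → ℝ) {M : Matrix ι ι ℂ} (hM : M.IsHermitian) :
    cfc f M = (hM.eigenvectorUnitary : Matrix ι ι ℂ) *
      diagonal (fun i => (f (hM.eigenvalues i) : ℂ)) *
      (hM.eigenvectorUnitary : Matrix ι ι ℂ)ᴴ := by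
  rw [hM.cfc_eq, IsHermitian.cfc, Unitary.conjStarAlgAut_apply]
  rfl

theorem posSemidef_cfc {f : ℝ → ℝ} {M : Matrix ι ι ℂ} (hM : M.IsHermitian)
    (h : ∀ i, 0 ≤ f (hM.eigenvalues i)) : (cfc f M).PosSemidef := by
  rw [cfc_eq_conj_diagonal f hM]
  refine PosSemidef.mul_mul_conjTranspose_same (PosSemidef.diagonal fun i => ?_) _
  simpa using h i

theorem trace_mul_cfc (K : Matrix ι ι ℂ) (g : ℝ → ℝ) {M : Matrix ι ι ℂ} (hM : M.IsHermitian) :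
    (K * cfc g M).trace = ∑ j, (g (hM.eigenvalues j) : ℂ) *
      ((hM.eigenvectorUnitary : Matrix ι ι ℂ)ᴴ * K * hM.eigenvectorUnitary) j j := by
  rw [cfc_eq_conj_diagonal g hM, ← Matrix.mul_assoc, Matrix.trace_mul_comm, ← Matrix.mul_assoc,
    ← Matrix.mul_assoc]
  simp [Matrix.trace, Matrix.mul_diagonal, mul_comm]

theorem conjTranspose_mul_eigenvectorUnitary {M : Matrix ι ι ℂ} (hM : M.IsHermitian) :
    (hM.eigenvectorUnitary : Matrix ι ι ℂ)ᴴ * hM.eigenvectorUnitary = 1 :=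
  Unitary.coe_star_mul_self hM.eigenvectorUnitary

theorem trace_cfc (g : ℝ → ℝ) {M : Matrix ι ι ℂ} (hM : M.IsHermitian) :
    (cfc g M).trace = ∑ j, (g (hM.eigenvalues j) : ℂ) := by
  have h := trace_mul_cfc 1 g hM
  simpa [conjTranspose_mul_eigenvectorUnitary] using h

theorem cfc_id_of_isHermitian {M : Matrix ι ι ℂ} (hM : M.IsHermitian) :
    cfc (fun x : ℝ => x) M = M :=
  cfc_id' ℝ M hM

theorem cfc_mul_self (f : ℝ → ℝ) {M : Matrix ι ι ℂ} (hM : M.IsHermitian) :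
    cfc f M * M = cfc (fun x => f x * x) M := by
  rw [← cfc_mul_cfc, cfc_id_of_isHermitian hM]

theorem self_mul_cfc (f : ℝ → ℝ) {M : Matrix ι ι ℂ} (hM : M.IsHermitian) :
    M * cfc f M = cfc (fun x => x * f x) M := by
  rw [← cfc_mul_cfc, cfc_id_of_isHermitian hM]

theorem opAbs_eq_cfc_abs {Y : Matrix ι ι ℂ} (hY : Y.IsHermitian) :
    opAbs Y = cfc (fun x : ℝ => |x|) Y := by
  have h : Yᴴ * Y = cfc (fun x : ℝ => x * x) Y := by
    rw [← cfc_mul_cfc, cfc_id_of_isHermitian hY, hY.eq]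
  rw [opAbs, h, cfc_cfc _ _ hY]
  simp [Real.sqrt_mul_self_eq_abs]

theorem opAbs_cfc (f : ℝ → ℝ) {Y : Matrix ι ι ℂ} (hY : Y.IsHermitian) :
    opAbs (cfc f Y) = cfc (fun x : ℝ => |f x|) Y := by
  rw [opAbs_eq_cfc_abs (isHermitian_cfc f Y), cfc_cfc _ _ hY]

theorem traceNorm_eq_sum {Y : Matrix ι ι ℂ} (hY : Y.IsHermitian) :
    traceNorm Y = ∑ j, |hY.eigenvalues j| := by
  rw [traceNorm, opAbs_eq_cfc_abs hY, trace_cfc _ hY]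
  simp

theorem schattenNorm_cfc (α : ℝ) (f : ℝ → ℝ) {Y : Matrix ι ι ℂ} (hY : Y.IsHermitian) :
    schattenNorm α (cfc f Y) = (∑ j, |f (hY.eigenvalues j)| ^ α) ^ (1 / α) := by
  rw [schattenNorm, opAbs_cfc f hY, cfc_cfc _ _ hY, trace_cfc _ hY]
  simp

theorem schattenNorm_eq_sum (α : ℝ) {Y : Matrix ι ι ℂ} (hY : Y.IsHermitian) :
    schattenNorm α Y = (∑ j, |hY.eigenvalues j| ^ α) ^ (1 / α) := by
  have h := schattenNorm_cfc α (fun x => x) hY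
  rwa [cfc_id_of_isHermitian hY] at h

open scoped Matrix.Norms.L2Operator in
theorem operatorNorm_cfc_le {f : ℝ → ℝ} {Y : Matrix ι ι ℂ} (hY : Y.IsHermitian) {c : ℝ}
    (hc : 0 ≤ c) (h : ∀ i, |f (hY.eigenvalues i)| ≤ c) : operatorNorm (cfc f Y) ≤ c := by
  rw [operatorNorm, ← Matrix.cstar_norm_def, cfc_eq_conj_diagonal f hY,
    ← star_eq_conjTranspose]
  rw [CStarRing.norm_mul_mem_unitary _ (Unitary.star_mem hY.eigenvectorUnitary.2),
    CStarRing.norm_mem_unitary_mul _ hY.eigenvectorUnitary.2, l2_opNorm_diagonal,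
    pi_norm_le_iff_of_nonneg hc]
  simpa using h

open scoped Matrix.Norms.L2Operator in
theorem abs_eigenvalues_le_operatorNorm {Y : Matrix ι ι ℂ} (hY : Y.IsHermitian) (i : ι) :
    |hY.eigenvalues i| ≤ operatorNorm Y := by
  have : Nonempty ι := ⟨i⟩
  rw [operatorNorm, ← Matrix.cstar_norm_def, ← Real.norm_eq_abs]
  exact spectrum.norm_le_norm_of_mem (hY.eigenvalues_mem_spectrum_real i)

end FunctionalCalculus

/-! ### The trace norm as a lower bound for every state σ. -/

section LowerBound

open Matrix

variable {ι : Type*} [Fintype ι] [DecidableEq ι]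

/-- Passing to orthogonal complements turns the support inclusion into ker σ ≤ ker X, which applies
to each column of Q. -/
theorem mul_eq_zero_of_supp_le {X σ Q : Matrix ι ι ℂ} (h : supp X ≤ supp σ) (hQ : σ * Q = 0) :
    X * Q = 0 := by
  have hker : LinearMap.ker (Matrix.toEuclideanCLM (𝕜 := ℂ) σ).toLinearMap ≤
      LinearMap.ker (Matrix.toEuclideanCLM (𝕜 := ℂ) X).toLinearMap :=
    Submodule.orthogonal_le_orthogonal_iff.mp h
  ext i j
  have hmem : WithLp.toLp 2 (Q.col j) ∈
      LinearMap.ker (Matrix.toEuclideanCLM (𝕜 := ℂ) σ).toLinearMap := by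
    have h0 : σ *ᵥ Q.col j = 0 := by
      ext k
      exact congrFun (congrFun hQ k) j
    simp [Matrix.toEuclideanCLM_toLp, h0]
  have h1 := hker hmem
  have h2 : X *ᵥ Q.col j = 0 := by
    simpa [Matrix.toEuclideanCLM_toLp] using h1
  exact congrFun h2 i

theorem supp_le_of_mul_eq {X σ C : Matrix ι ι ℂ} (h : C * σ = X) : supp X ≤ supp σ := by
  refine Submodule.orthogonal_le fun v hv => ?_
  have hv' : Matrix.toEuclideanCLM (𝕜 := ℂ) σ v = 0 := hv
  change Matrix.toEuclideanCLM (𝕜 := ℂ) X v = 0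
  rw [← h, map_mul, mul_apply_eq_comp, hv', map_zero]

theorem isHermitian_suppPow (σ : Matrix ι ι ℂ) (r : ℝ) : (suppPow σ r).IsHermitian :=
  isHermitian_cfc _ _

theorem suppPow_mul_suppPow {σ : Matrix ι ι ℂ} (hσ : σ.PosSemidef) (r s : ℝ) :
    suppPow σ r * suppPow σ s = suppPow σ (r + s) := by
  rw [suppPow, suppPow, suppPow, cfc_mul_cfc]
  refine cfc_congr_of_isHermitian hσ.isHermitian fun i => ?_
  by_cases h : hσ.isHermitian.eigenvalues i = 0
  · simp [h]
  · simp only [h, if_false]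
    rw [Real.rpow_add (lt_of_le_of_ne (hσ.eigenvalues_nonneg i) (Ne.symm h))]

/-- The zeroth power is the projection onto the support of σ, not the identity; its complement is
killed by σ, hence by X. -/
theorem mul_suppPow_zero {X σ : Matrix ι ι ℂ} (hσ : σ.IsHermitian) (h : supp X ≤ supp σ) :
    X * suppPow σ 0 = X := by
  have hQ : σ * (1 - suppPow σ 0) = 0 := by
    have h1 : σ * suppPow σ 0 = σ := by
      rw [suppPow, self_mul_cfc _ hσ]
      refine (cfc_congr fun x _ => ?_).trans (cfc_id_of_isHermitian hσ)
      by_cases hx : x = 0 <;> simp [hx]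
    rw [mul_sub, mul_one, h1, sub_self]
  have h2 := mul_eq_zero_of_supp_le h hQ
  rw [mul_sub, mul_one, sub_eq_zero] at h2
  exact h2.symm

theorem suppPow_zero_mul {X σ : Matrix ι ι ℂ} (hσ : σ.IsHermitian) (hX : X.IsHermitian)
    (h : supp X ≤ supp σ) : suppPow σ 0 * X = X := by
  have h1 := congrArg Matrix.conjTranspose (mul_suppPow_zero hσ h)
  rwa [conjTranspose_mul, hX.eq, (isHermitian_suppPow σ 0).eq] at h1

omit [DecidableEq ι] in
theorem abs_diag_conj_le {S K L : Matrix ι ι ℂ} (h₁ : (L - K).PosSemidef)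
    (h₂ : (L + K).PosSemidef) (i : ι) :
    |((Sᴴ * K * S) i i).re| ≤ ((Sᴴ * L * S) i i).re := by
  have a := (h₁.conjTranspose_mul_mul_same S).diag_nonneg (i := i)
  have b := (h₂.conjTranspose_mul_mul_same S).diag_nonneg (i := i)
  rw [Matrix.mul_sub, Matrix.sub_mul, Matrix.sub_apply] at a
  rw [Matrix.mul_add, Matrix.add_mul, Matrix.add_apply] at b
  have a' := (Complex.le_def.mp a).1
  have b' := (Complex.le_def.mp b).1
  simp only [Complex.zero_re, Complex.sub_re, Complex.add_re] at a' b'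
  rw [abs_le]
  constructor <;> linarith

/-- The squared moduli of the overlaps of two eigenbases. -/
def overlap {σ Z : Matrix ι ι ℂ} (hσ : σ.IsHermitian) (hZ : Z.IsHermitian) (i j : ι) : ℝ :=
  Complex.normSq (((hσ.eigenvectorUnitary : Matrix ι ι ℂ)ᴴ *
    (hZ.eigenvectorUnitary : Matrix ι ι ℂ)) i j)

theorem overlap_nonneg {σ Z : Matrix ι ι ℂ} (hσ : σ.IsHermitian) (hZ : Z.IsHermitian) (i j : ι) :
    0 ≤ overlap hσ hZ i j :=
  Complex.normSq_nonneg _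

theorem diag_conj_cfc {σ Z : Matrix ι ι ℂ} (hσ : σ.IsHermitian) (hZ : Z.IsHermitian) (f : ℝ → ℝ)
    (j : ι) :
    (((hZ.eigenvectorUnitary : Matrix ι ι ℂ)ᴴ * cfc f σ * hZ.eigenvectorUnitary) j j).re =
      ∑ i, f (hσ.eigenvalues i) * overlap hσ hZ i j := by
  set V : Matrix ι ι ℂ := (hZ.eigenvectorUnitary : Matrix ι ι ℂ) with hV
  set U : Matrix ι ι ℂ := (hσ.eigenvectorUnitary : Matrix ι ι ℂ) with hU
  have h : Vᴴ * cfc f σ * V =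
      (Uᴴ * V)ᴴ * (diagonal (fun i => (f (hσ.eigenvalues i) : ℂ)) * (Uᴴ * V)) := by
    rw [cfc_eq_conj_diagonal f hσ, conjTranspose_mul, conjTranspose_conjTranspose]
    simp only [Matrix.mul_assoc, ← hU]
  rw [h, Matrix.mul_apply, Complex.re_sum]
  refine Finset.sum_congr rfl fun i _ => ?_
  rw [Matrix.diagonal_mul, Matrix.conjTranspose_apply, overlap, ← hU, ← hV, Complex.normSq_apply]
  simp only [Complex.star_def, Complex.mul_re, Complex.conj_re, Complex.conj_im, Complex.mul_im,
    Complex.ofReal_re, Complex.ofReal_im]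
  ring

theorem sum_overlap_left {σ Z : Matrix ι ι ℂ} (hσ : σ.IsHermitian) (hZ : Z.IsHermitian) (j : ι) :
    ∑ i, overlap hσ hZ i j = 1 := by
  have h := diag_conj_cfc hσ hZ (fun _ => 1) j
  have h1 : cfc (fun _ : ℝ => (1 : ℝ)) σ = 1 := cfc_const_one ℝ σ hσ
  rw [h1, Matrix.mul_one, conjTranspose_mul_eigenvectorUnitary] at h
  simpa using h.symm

theorem overlap_comm {σ Z : Matrix ι ι ℂ} (hσ : σ.IsHermitian) (hZ : Z.IsHermitian) (i j : ι) :
    overlap hσ hZ i j = overlap hZ hσ j i := by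
  have h : (hZ.eigenvectorUnitary : Matrix ι ι ℂ)ᴴ * (hσ.eigenvectorUnitary : Matrix ι ι ℂ) =
      ((hσ.eigenvectorUnitary : Matrix ι ι ℂ)ᴴ * (hZ.eigenvectorUnitary : Matrix ι ι ℂ))ᴴ := by
    rw [conjTranspose_mul, conjTranspose_conjTranspose]
  rw [overlap, overlap, h, conjTranspose_apply, Complex.star_def, Complex.normSq_conj]

theorem sum_overlap_right {σ Z : Matrix ι ι ℂ} (hσ : σ.IsHermitian) (hZ : Z.IsHermitian) (i : ι) :
    ∑ j, overlap hσ hZ i j = 1 := by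
  simp only [overlap_comm hσ hZ]
  exact sum_overlap_left hZ hσ i

/-- The exponent is `2t`, since `σ^t (1 ± sgn X) σ^t ≥ 0` bounds the sign of `X` by the identity. -/
theorem traceNorm_le_sum_overlap {X σ Z : Matrix ι ι ℂ} (hX : X.IsHermitian) (hσ : σ.PosSemidef)
    (hsupp : supp X ≤ supp σ) (t : ℝ) (hZ : Z.IsHermitian)
    (hZdef : Z = suppPow σ (-t) * X * suppPow σ (-t)) :
    traceNorm X ≤ ∑ j, |hZ.eigenvalues j| * ∑ i,
      (if hσ.isHermitian.eigenvalues i = 0 then 0 else hσ.isHermitian.eigenvalues i ^ (2 * t)) *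
        overlap hσ.isHermitian hZ i j := by
  set T := suppPow σ t with hT
  have hTherm : Tᴴ = T := (isHermitian_suppPow σ t).eq
  have hXZ : X = T * Z * T := by
    have h1 : T * suppPow σ (-t) = suppPow σ 0 := by
      rw [hT, suppPow_mul_suppPow hσ, add_neg_cancel]
    have h2 : suppPow σ (-t) * T = suppPow σ 0 := by
      rw [hT, suppPow_mul_suppPow hσ, neg_add_cancel]
    calc X = suppPow σ 0 * X * suppPow σ 0 := by
          rw [suppPow_zero_mul hσ.isHermitian hX hsupp, mul_suppPow_zero hσ.isHermitian hsupp]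
      _ = T * Z * T := by
          -- The left projection is split as σ^t σ^(-t), the right one as σ^(-t) σ^t.
          rw [hZdef, ← h1]
          nth_rw 2 [h1]
          rw [← h2]
          simp only [Matrix.mul_assoc]
  -- Since sign 0 = 0, S need not be unitary; only -1 ≤ S ≤ 1 and S X = |X| are needed.
  set f : ℝ → ℝ := fun x => (SignType.sign x : ℝ) with hf
  set S := cfc f X with hS
  set K := T * S * T with hK
  have hf1 : ∀ x, f x ≤ 1 ∧ -1 ≤ f x := by
    intro x
    rcases lt_trichotomy x 0 with h | h | h <;> simp [hf, h]
  have hone : (1 : Matrix ι ι ℂ) = cfc (fun _ : ℝ => (1 : ℝ)) X := (cfc_const_one ℝ X hX).symm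
  have hsub : (1 - S).PosSemidef := by
    rw [hone, hS, ← cfc_sub _ _ X (continuousOn_spectrum _ X) (continuousOn_spectrum _ X)]
    exact posSemidef_cfc hX fun i => sub_nonneg.mpr (hf1 _).1
  have hadd : (1 + S).PosSemidef := by
    rw [hone, hS, ← cfc_add X _ _ (continuousOn_spectrum _ X) (continuousOn_spectrum _ X)]
    exact posSemidef_cfc hX fun i => by linarith [(hf1 (hX.eigenvalues i)).2]
  have hTT : T * T = suppPow σ (2 * t) := by rw [hT, suppPow_mul_suppPow hσ, two_mul]
  have hKsub : (suppPow σ (2 * t) - K).PosSemidef := by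
    have h := hsub.conjTranspose_mul_mul_same T
    rwa [hTherm, Matrix.mul_sub, Matrix.sub_mul, Matrix.mul_one, hTT] at h
  have hKadd : (suppPow σ (2 * t) + K).PosSemidef := by
    have h := hadd.conjTranspose_mul_mul_same T
    rwa [hTherm, Matrix.mul_add, Matrix.add_mul, Matrix.mul_one, hTT] at h
  have htr : opAbs X = S * X := by
    rw [hS, opAbs_eq_cfc_abs hX, cfc_mul_self _ hX]
    simp [hf]
  have htrace : (S * X).trace = (K * Z).trace := by
    rw [hXZ, ← Matrix.mul_assoc, Matrix.trace_mul_comm, hK]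
    simp only [Matrix.mul_assoc]
  have htrK := trace_mul_cfc K (fun x => x) hZ
  rw [cfc_id_of_isHermitian hZ] at htrK
  rw [traceNorm, htr, htrace, htrK, Complex.re_sum]
  refine Finset.sum_le_sum fun j _ => ?_
  rw [Complex.re_ofReal_mul]
  refine (le_abs_self _).trans ?_
  rw [abs_mul]
  refine mul_le_mul_of_nonneg_left ?_ (abs_nonneg _)
  refine (abs_diag_conj_le hKsub hKadd j).trans_eq ?_
  rw [suppPow, diag_conj_cfc hσ.isHermitian hZ]

theorem sum_eigenvalues_of_isState {σ : Matrix ι ι ℂ} (hσ : IsState σ) :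
    ∑ i, hσ.1.isHermitian.eigenvalues i = 1 := by
  have h := hσ.2.symm.trans hσ.1.isHermitian.trace_eq_sum_eigenvalues
  simpa using (congrArg Complex.re h).symm

theorem isHermitian_suppPow_conj {X : Matrix ι ι ℂ} (hX : X.IsHermitian) (σ : Matrix ι ι ℂ)
    (r : ℝ) : (suppPow σ r * X * suppPow σ r).IsHermitian := by
  have h := isHermitian_conjTranspose_mul_mul (suppPow σ r) hX
  rwa [(isHermitian_suppPow σ r).eq] at h

/-- With p and q the eigenvalues of σ and Z and W the overlaps, this is Hölder for the probability
weights p_i W_ij on pairs (i, j). -/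
theorem traceNorm_le_schattenNorm {X σ : Matrix ι ι ℂ} (hX : X.IsHermitian) (hσ : IsState σ)
    (hsupp : supp X ≤ supp σ) {α : ℝ} (hα : 1 ≤ α) :
    traceNorm X ≤ schattenNorm α
      (suppPow σ ((1 - α) / (2 * α)) * X * suppPow σ ((1 - α) / (2 * α))) := by
  have hα0 : 0 < α := by linarith
  set t : ℝ := -((1 - α) / (2 * α)) with ht
  have ht2 : 2 * t = 1 - α⁻¹ := by rw [ht]; field_simp; ring
  have hZ := isHermitian_suppPow_conj hX σ ((1 - α) / (2 * α))
  refine (traceNorm_le_sum_overlap hX hσ.1 hsupp t hZ (by rw [ht, neg_neg])).trans ?_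
  rw [schattenNorm_eq_sum α hZ, ht2]
  set q := hZ.eigenvalues
  set p := hσ.1.isHermitian.eigenvalues with hp
  have hp0 : ∀ i, 0 ≤ p i := hσ.1.eigenvalues_nonneg
  set W := overlap hσ.1.isHermitian hZ
  have hW : ∀ i j, 0 ≤ W i j := overlap_nonneg _ _
  let w : ι × ι → ℝ := fun x => p x.1 * W x.1 x.2
  -- Chosen so that w g = p_i^(1-1/α) W_ij |q_j|, while in w g^α the factor p_i cancels.
  let g : ι × ι → ℝ := fun x => p x.1 ^ (-α⁻¹) * |q x.2|
  have hw : ∀ x, 0 ≤ w x := fun x => mul_nonneg (hp0 _) (hW _ _)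
  have hg : ∀ x, 0 ≤ g x := fun x => mul_nonneg (Real.rpow_nonneg (hp0 _) _) (abs_nonneg _)
  have hsum : ∑ x, w x = 1 := by
    rw [Fintype.sum_prod_type]
    simp only [w, ← Finset.mul_sum]
    simp only [W, sum_overlap_right, mul_one]
    exact sum_eigenvalues_of_isState hσ
  have key := Real.inner_le_weight_mul_Lp_of_nonneg Finset.univ hα w g hw hg
  rw [hsum, Real.one_rpow, one_mul] at key
  have hlhs : ∑ j, |q j| * ∑ i, (if p i = 0 then 0 else p i ^ (1 - α⁻¹)) * W i j =
      ∑ x, w x * g x := by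
    rw [Fintype.sum_prod_type_right]
    refine Finset.sum_congr rfl fun j _ => ?_
    rw [Finset.mul_sum]
    refine Finset.sum_congr rfl fun i _ => ?_
    by_cases h : p i = 0
    · simp [w, g, h]
    · have : p i ^ (1 - α⁻¹) = p i * p i ^ (-α⁻¹) := by
        rw [sub_eq_add_neg, Real.rpow_add (lt_of_le_of_ne (hp0 i) (Ne.symm h)), Real.rpow_one]
      simp only [w, g, h, if_false, this]
      ring
  rw [hlhs, one_div]
  refine key.trans (Real.rpow_le_rpow ?_ ?_ (inv_nonneg.mpr hα0.le))
  · exact Finset.sum_nonneg fun x _ => mul_nonneg (hw x) (Real.rpow_nonneg (hg x) _)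
  · rw [Fintype.sum_prod_type_right]
    refine Finset.sum_le_sum fun j _ => ?_
    -- Indices with p_i = 0 contribute nothing on the left, hence only an inequality.
    calc ∑ i, w (i, j) * g (i, j) ^ α ≤ ∑ i, W i j * |q j| ^ α := by
          refine Finset.sum_le_sum fun i _ => ?_
          have hq := Real.rpow_nonneg (abs_nonneg (q j)) α
          by_cases h : p i = 0
          · simpa [w, h] using mul_nonneg (hW i j) hq
          · have hpi : 0 < p i := lt_of_le_of_ne (hp0 i) (Ne.symm h)
            have h1 : (p i ^ (-α⁻¹)) ^ α = (p i)⁻¹ := by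
              rw [← Real.rpow_mul hpi.le, neg_mul, inv_mul_cancel₀ hα0.ne', Real.rpow_neg_one]
            have h2 : w (i, j) * g (i, j) ^ α = W i j * |q j| ^ α := by
              simp only [w, g]
              rw [Real.mul_rpow (Real.rpow_nonneg hpi.le _) (abs_nonneg _), h1]
              field_simp
            exact h2.le
      _ = |q j| ^ α := by
          rw [← Finset.sum_mul, sum_overlap_left, one_mul]

/-- Here 2t = 1, so the weights p_i W_ij sum to 1 and bounding each |q_j| by the operator norm
replaces Hölder. -/
theorem traceNorm_le_operatorNorm {X σ : Matrix ι ι ℂ} (hX : X.IsHermitian) (hσ : IsState σ)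
    (hsupp : supp X ≤ supp σ) :
    traceNorm X ≤ operatorNorm (suppPow σ (-1 / 2) * X * suppPow σ (-1 / 2)) := by
  have hZ := isHermitian_suppPow_conj hX σ (-1 / 2)
  refine (traceNorm_le_sum_overlap hX hσ.1 hsupp (1 / 2) hZ (by norm_num)).trans ?_
  set N := operatorNorm (suppPow σ (-1 / 2) * X * suppPow σ (-1 / 2))
  set p := hσ.1.isHermitian.eigenvalues with hp
  have hp0 : ∀ i, 0 ≤ p i := hσ.1.eigenvalues_nonneg
  have hpow : ∀ i, (if p i = 0 then 0 else p i ^ (2 * (1 / 2) : ℝ)) = p i := by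
    intro i
    by_cases h : p i = 0 <;> simp [h]
  simp only [hpow]
  calc ∑ j, |hZ.eigenvalues j| * ∑ i, p i * overlap hσ.1.isHermitian hZ i j
      ≤ ∑ j, N * ∑ i, p i * overlap hσ.1.isHermitian hZ i j :=
        Finset.sum_le_sum fun j _ => mul_le_mul_of_nonneg_right
          (abs_eigenvalues_le_operatorNorm hZ j)
          (Finset.sum_nonneg fun i _ => mul_nonneg (hp0 i) (overlap_nonneg _ _ i j))
    _ = N := by
        rw [← Finset.mul_sum, Finset.sum_comm]
        simp only [← Finset.mul_sum, sum_overlap_right, mul_one]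
        rw [sum_eigenvalues_of_isState hσ, mul_one]

end LowerBound

/-! ### Attainment at the normalized absolute value. -/

section Attainment

open Matrix

variable {ι : Type*} [Fintype ι] [DecidableEq ι]

theorem traceNorm_pos {X : Matrix ι ι ℂ} (hX : X.IsHermitian) (h0 : X.trace ≠ 0) :
    0 < traceNorm X := by
  rw [traceNorm_eq_sum hX]
  refine lt_of_le_of_ne (Finset.sum_nonneg fun _ _ => abs_nonneg _) fun h => h0 ?_
  have h1 := (Finset.sum_eq_zero_iff_of_nonneg fun i _ => abs_nonneg (hX.eigenvalues i)).mp h.symm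
  rw [hX.trace_eq_sum_eigenvalues]
  exact Finset.sum_eq_zero fun i hi => by simpa using h1 i hi

/-- The state `|X| / ‖X‖₁`. -/
def normalizedAbs (X : Matrix ι ι ℂ) : Matrix ι ι ℂ :=
  ((traceNorm X)⁻¹ : ℂ) • opAbs X

theorem normalizedAbs_eq_cfc {X : Matrix ι ι ℂ} (hX : X.IsHermitian) :
    normalizedAbs X = cfc (fun x : ℝ => (traceNorm X)⁻¹ * |x|) X := by
  rw [normalizedAbs, opAbs_eq_cfc_abs hX, cfc_eq_conj_diagonal _ hX, cfc_eq_conj_diagonal _ hX,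
    ← Matrix.smul_mul, ← Matrix.mul_smul, ← Matrix.diagonal_smul]
  congr 3
  ext i
  simp

theorem isState_normalizedAbs {X : Matrix ι ι ℂ} (hX : X.IsHermitian) (h : 0 < traceNorm X) :
    IsState (normalizedAbs X) := by
  rw [normalizedAbs_eq_cfc hX]
  refine ⟨posSemidef_cfc hX fun i => by positivity, ?_⟩
  rw [trace_cfc _ hX, ← Complex.ofReal_sum, ← Finset.mul_sum, ← traceNorm_eq_sum hX,
    inv_mul_cancel₀ h.ne', Complex.ofReal_one]

theorem supp_le_supp_normalizedAbs {X : Matrix ι ι ℂ} (hX : X.IsHermitian)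
    (h : 0 < traceNorm X) : supp X ≤ supp (normalizedAbs X) := by
  -- Polar decomposition: ‖X‖₁ sgn(X) times |X|/‖X‖₁ is X.
  refine supp_le_of_mul_eq (C := cfc (fun x : ℝ => traceNorm X * (SignType.sign x : ℝ)) X) ?_
  rw [normalizedAbs_eq_cfc hX, cfc_mul_cfc]
  refine (cfc_congr fun x _ => ?_).trans (cfc_id_of_isHermitian hX)
  have h2 : (SignType.sign x : ℝ) * |x| = x := sign_mul_abs x
  calc traceNorm X * (SignType.sign x : ℝ) * ((traceNorm X)⁻¹ * |x|)
      = (traceNorm X * (traceNorm X)⁻¹) * ((SignType.sign x : ℝ) * |x|) := by ring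
    _ = x := by rw [mul_inv_cancel₀ h.ne', h2, one_mul]

theorem suppPow_normalizedAbs_conj {X : Matrix ι ι ℂ} (hX : X.IsHermitian)
    (h : 0 < traceNorm X) (r : ℝ) :
    suppPow (normalizedAbs X) r * X * suppPow (normalizedAbs X) r =
      cfc (fun x : ℝ => ((traceNorm X)⁻¹ * |x|) ^ (2 * r) * x) X := by
  rw [suppPow, normalizedAbs_eq_cfc hX, cfc_cfc _ _ hX]
  rw [cfc_mul_self _ hX, cfc_mul_cfc]
  refine cfc_congr fun x _ => ?_
  by_cases hx : x = 0
  · simp [hx]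
  · have hpos : 0 < (traceNorm X)⁻¹ * |x| := by positivity
    simp only [hpos.ne', if_false]
    rw [two_mul, Real.rpow_add hpos]
    ring

/-- With c = ‖X‖₁, an eigenvalue x contributes (|x|/c)^(1-α) |x|^α = c^(α-1) |x|; these sum to c^α.
-/
theorem schattenNorm_normalizedAbs_conj {X : Matrix ι ι ℂ} (hX : X.IsHermitian)
    (h : 0 < traceNorm X) {α : ℝ} (hα : 1 ≤ α) :
    schattenNorm α (suppPow (normalizedAbs X) ((1 - α) / (2 * α)) * X *
      suppPow (normalizedAbs X) ((1 - α) / (2 * α))) = traceNorm X := by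
  have hα0 : 0 < α := by linarith
  rw [suppPow_normalizedAbs_conj hX h, schattenNorm_cfc α _ hX]
  set c := traceNorm X with hc
  have hterm : ∀ x : ℝ, |(c⁻¹ * |x|) ^ (2 * ((1 - α) / (2 * α))) * x| ^ α =
      c ^ (α - 1) * |x| := by
    intro x
    by_cases hx : x = 0
    · simp [hx, hα0.ne']
    · have hx' : 0 < |x| := abs_pos.mpr hx
      have hpos : 0 < c⁻¹ * |x| := by positivity
      have he : 2 * ((1 - α) / (2 * α)) * α = 1 - α := by field_simp
      rw [abs_mul, abs_of_nonneg (Real.rpow_nonneg hpos.le _),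
        Real.mul_rpow (Real.rpow_nonneg hpos.le _) hx'.le, ← Real.rpow_mul hpos.le, he,
        Real.mul_rpow (inv_nonneg.mpr h.le) hx'.le, mul_assoc, ← Real.rpow_add hx',
        sub_add_cancel, Real.rpow_one, Real.inv_rpow h.le, ← Real.rpow_neg h.le, neg_sub]
  simp only [hterm]
  rw [← Finset.mul_sum, ← traceNorm_eq_sum hX, ← hc]
  nth_rw 2 [← Real.rpow_one c]
  rw [← Real.rpow_add h, sub_add_cancel, ← Real.rpow_mul h.le, mul_one_div_cancel hα0.ne',
    Real.rpow_one]

theorem operatorNorm_normalizedAbs_conj_le {X : Matrix ι ι ℂ} (hX : X.IsHermitian)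
    (h : 0 < traceNorm X) :
    operatorNorm (suppPow (normalizedAbs X) (-1 / 2) * X * suppPow (normalizedAbs X) (-1 / 2)) ≤
      traceNorm X := by
  rw [suppPow_normalizedAbs_conj hX h]
  refine operatorNorm_cfc_le hX h.le fun i => ?_
  set x := hX.eigenvalues i
  by_cases hx : x = 0
  · simpa [hx] using h.le
  · have hx' : 0 < |x| := abs_pos.mpr hx
    have hpos : 0 < (traceNorm X)⁻¹ * |x| := by positivity
    have he : (2 * (-1 / 2) : ℝ) = -1 := by norm_num
    rw [he, Real.rpow_neg_one, abs_mul, abs_of_pos (inv_pos.mpr hpos), mul_inv, inv_inv,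
      mul_assoc, inv_mul_cancel₀ hx'.ne', mul_one]

end Attainment

/-! ### Partial transpose and membership in PPT. -/

section Main

open Matrix

theorem isHermitian_partialTranspose {A B : Type*} {Y : Matrix (A × B) (A × B) ℂ} (hY : Y.IsHermitian) :
    (partialTranspose Y).IsHermitian := by
  ext x y
  exact hY.apply (x.1, y.2) (y.1, x.2)

theorem trace_partialTranspose {A B : Type*} [Fintype A] [Fintype B]
    (Y : Matrix (A × B) (A × B) ℂ) :
    (partialTranspose Y).trace = Y.trace :=
  rfl

theorem normalizedAbs_mem_PPT {A B : Type*} [Fintype A] [DecidableEq A] [Fintype B]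
    [DecidableEq B] {X : Matrix (A × B) (A × B) ℂ} (hX : X.IsHermitian)
    (h : 0 < traceNorm X) (hpt : (partialTranspose (opAbs X)).PosSemidef) :
    normalizedAbs X ∈ PPT A B := by
  refine ⟨isState_normalizedAbs hX h, ?_⟩
  have h1 : partialTranspose (normalizedAbs X) =
      ((traceNorm X)⁻¹ : ℂ) • partialTranspose (opAbs X) := rfl
  rw [h1]
  refine hpt.smul ?_
  rw [← Complex.ofReal_inv]
  exact_mod_cast (inv_pos.mpr h).le

end Main

end AlphaLogNeg
end

theorem mainTheorem9 {A B : Type*} [Fintype A] [DecidableEq A] [Fintype B] [DecidableEq B]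
    (ρ : Matrix (A × B) (A × B) ℂ) (hρ : AlphaLogNeg.IsState ρ)
    (hbin : (AlphaLogNeg.partialTranspose
      (AlphaLogNeg.opAbs (AlphaLogNeg.partialTranspose ρ))).PosSemidef) :
    (∀ α : ℝ, 1 ≤ α →
      AlphaLogNeg.alphaLogNegativity α ρ = (AlphaLogNeg.logNegativity ρ : EReal)) ∧
    AlphaLogNeg.maxLogNegativity ρ = (AlphaLogNeg.logNegativity ρ : EReal) := by
  have hX := AlphaLogNeg.isHermitian_partialTranspose hρ.1.isHermitian
  have hpos : 0 < AlphaLogNeg.traceNorm (AlphaLogNeg.partialTranspose ρ) := by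
    refine AlphaLogNeg.traceNorm_pos hX ?_
    rw [AlphaLogNeg.trace_partialTranspose, hρ.2]
    exact one_ne_zero
  have hmem := AlphaLogNeg.normalizedAbs_mem_PPT hX hpos hbin
  have hsupp := AlphaLogNeg.supp_le_supp_normalizedAbs hX hpos
  refine ⟨fun α hα => le_antisymm ?_ ?_, le_antisymm ?_ ?_⟩
  · refine (iInf₂_le _ hmem).trans ?_
    rw [AlphaLogNeg.nu, if_pos hsupp, AlphaLogNeg.schattenNorm_normalizedAbs_conj hX hpos hα,
      AlphaLogNeg.logNegativity]
  · refine le_iInf₂ fun σ hσ => ?_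
    rw [AlphaLogNeg.nu]
    split_ifs with h
    · exact EReal.coe_le_coe_iff.mpr (Real.logb_le_logb_of_le one_lt_two hpos
        (AlphaLogNeg.traceNorm_le_schattenNorm hX hσ.1 h hα))
    · exact le_top
  · refine (iInf₂_le _ hmem).trans ?_
    rw [AlphaLogNeg.nuInf, if_pos hsupp]
    -- Monotonicity of the logarithm needs a positive smaller argument; the lower bound at this same
    -- σ supplies it.
    exact EReal.coe_le_coe_iff.mpr (Real.logb_le_logb_of_le one_lt_two
      (hpos.trans_le (AlphaLogNeg.traceNorm_le_operatorNorm hX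
        (AlphaLogNeg.isState_normalizedAbs hX hpos) hsupp))
      (AlphaLogNeg.operatorNorm_normalizedAbs_conj_le hX hpos))
  · refine le_iInf₂ fun σ hσ => ?_
    rw [AlphaLogNeg.nuInf]
    split_ifs with h
    · exact EReal.coe_le_coe_iff.mpr (Real.logb_le_logb_of_le one_lt_two hpos
        (AlphaLogNeg.traceNorm_le_operatorNorm hX hσ.1 h))
    · exact le_top
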